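/- Let $R$ be $\mathbb{R}$ or $\mathbb{C}$, and let $\mathscr{V}$ be either the category of seminormed vector spaces over $R$ or its full subcategory of normed vector spaces over $R$, in both cases with the nonexpansive linear maps as morphisms. For $V, W \in \mathscr{V}$ let $\underline{\mathscr{V}}(V,W) \in \mathscr{V}$ be the internal hom, i.e. the space of all bounded linear maps $V \to W$ with the operator (semi)norm. Let $\mathbb{T} = (T, \eta, \mu)$ be the double-dualization monad on $\mathscr{V}$, with $TV = V^{**}$, induced by the dualization adjunction; let $\Sigma_T$ be the class of all morphisms $h$ for which $Th$ is an isomorphism in $\mathscr{V}$. Let $\mathscr{E}$ be the class of surjective morphisms and $\mathscr{M}$ the class of isometric embeddings (injective morphisms $f$ with $\|f(x)\| = \|x\|$ for all $x$). A morphism $e : A_1 \to A_2$ is called $\mathscr{V}$-orthogonal to $m : B_1 \to B_2$ if the commutative square formed by $\underline{\mathscr{V}}(A_2,m)$, $\underline{\mathscr{V}}(e,B_1)$, $\underline{\mathscr{V}}(e,B_2)$, $\underline{\mathscr{V}}(A_1,m)$ is a pullback in $\mathscr{V}$. A pair of classes $(\mathscr{D},\mathscr{C})$ is a $\mathscr{V}$-factorization-system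 if $\mathscr{C}$ consists of exactly the $m$ to which every $e \in \mathscr{D}$ is $\mathscr{V}$-orthogonal, $\mathscr{D}$ consists of exactly the $e$ that are $\mathscr{V}$-orthogonal to every $m \in \mathscr{C}$, and every morphism factors as a morphism in $\mathscr{D}$ followed by one in $\mathscr{C}$. It is $\mathscr{V}$-proper if $\underline{\mathscr{V}}(e,A)$ and $\underline{\mathscr{V}}(A,m)$ are monomorphisms for all $e \in \mathscr{D}$, $m \in \mathscr{C}$ and all objects $A$. A $\mathbb{T}$-closed $\mathscr{M}$-embedding is an $m \in \mathscr{M}$ such that every $h \in \Sigma_T$ is $\mathscr{V}$-orthogonal to $m$. A morphism is $\mathbb{T}$-dense if it is $\mathscr{V}$-orthogonal to every $\mathbb{T}$-closed $\mathscr{M}$-embedding. A $\mathbb{T}$-closure of an $m \in \mathscr{M}$ is a $\mathbb{T}$-closed $\mathscr{M}$-embedding $c$ for which $m = c \cdot d$ with $d$ $\mathbb{T}$-dense. Theorem. $(\mathscr{E},\mathscr{M})$ is a $\mathscr{V}$-proper $\mathscr{V}$-factorization-system on $\underline{\mathscr{V}}$, and the following hold. 1. A morphism in $\mathscr{V}$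 is $\mathbb{T}$-dense if and only if it is dense, i.e. has dense image. 2. A morphism in $\mathscr{V}$ is a $\mathbb{T}$-closed $\mathscr{M}$-embedding if and only if it is a closed isometric embedding, i.e. an isometric embedding with closed image. 3. Every morphism in $\mathscr{V}$ factors as a $\mathbb{T}$-dense morphism followed by a $\mathbb{T}$-closed $\mathscr{M}$-embedding. 4. The $\mathbb{T}$-closure of a linear subspace $S \hookrightarrow W$ of $W \in \mathscr{V}$ is its usual topological closure: a morphism $c : C \to W$ is a $\mathbb{T}$-closure of $S \hookrightarrow W$ if and only if $c$ is isomorphic, over $W$, to the inclusion $\overline{S} \hookrightarrow W$. -/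

import Mathlib

open CategoryTheory Opposite

universe u

namespace EnrichedClosure

/-! ### Density and closure relative to a monad

`B` is (the underlying ordinary category of) a `V`-category, and `H` is its hom bifunctor
`B(-,-) : Bᵒᵖ ⥤ B ⥤ V`.  A monad enters the notions of density and closure only through the class
of morphisms inverted by its underlying ordinary endofunctor, and the enrichment of `B` enters only
through the bifunctor `H`. -/

section General

universe v₁ v₂ u₁ u₂

variable {B : Type u₁} [Category.{v₁} B] {V : Type u₂} [Category.{v₂} V]

/-- `e : A₁ ⟶ A₂` is `V`-orthogonal to `m : B₁ ⟶ B₂`: the square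
```
B(A₂,B₁) --B(A₂,m)--> B(A₂,B₂)
   |                     |
B(e,B₁)               B(e,B₂)
   v                     v
B(A₁,B₁) --B(A₁,m)--> B(A₁,B₂)
```
is a pullback in `V`. -/
def VOrthogonal (H : Bᵒᵖ ⥤ B ⥤ V) {A₁ A₂ B₁ B₂ : B} (e : A₁ ⟶ A₂) (m : B₁ ⟶ B₂) : Prop :=
  IsPullback ((H.obj (op A₂)).map m) ((H.map e.op).app B₁)
    ((H.map e.op).app B₂) ((H.obj (op A₁)).map m)

/-- The class of all `m` such that every `e` in `E` is `V`-orthogonal to `m`. -/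
def rightOrthogonal (H : Bᵒᵖ ⥤ B ⥤ V) (E : MorphismProperty B) : MorphismProperty B :=
  fun _ _ m => ∀ ⦃A₁ A₂ : B⦄ (e : A₁ ⟶ A₂), E e → VOrthogonal H e m

/-- The class of all `e` that are `V`-orthogonal to every `m` in `M`. -/
def leftOrthogonal (H : Bᵒᵖ ⥤ B ⥤ V) (M : MorphismProperty B) : MorphismProperty B :=
  fun _ _ e => ∀ ⦃B₁ B₂ : B⦄ (m : B₁ ⟶ B₂), M m → VOrthogonal H e m

/-- `f` factors as a morphism in `E` followed by a morphism in `M`. -/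
def Factors (E M : MorphismProperty B) {X Y : B} (f : X ⟶ Y) : Prop :=
  ∃ (Z : B) (e : X ⟶ Z) (m : Z ⟶ Y), E e ∧ M m ∧ e ≫ m = f

/-- `(E, M)` is a `V`-factorization-system. -/
structure IsVFactorizationSystem (H : Bᵒᵖ ⥤ B ⥤ V) (E M : MorphismProperty B) : Prop where
  right_eq : rightOrthogonal H E = M
  left_eq : leftOrthogonal H M = E
  factors : ∀ {X Y : B} (f : X ⟶ Y), Factors E M f

/-- `(E, M)` is `V`-proper: `E` consists of `V`-epimorphisms and `M` of `V`-monomorphisms. -/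
structure IsVProper (H : Bᵒᵖ ⥤ B ⥤ V) (E M : MorphismProperty B) : Prop where
  vepi : ∀ {X Y : B} (e : X ⟶ Y), E e → ∀ A : B, Mono ((H.map e.op).app A)
  vmono : ∀ {X Y : B} (m : X ⟶ Y), M m → ∀ A : B, Mono ((H.obj (op A)).map m)

/-- The class of all morphisms inverted by the underlying endofunctor of `T`. -/
def invertedBy (T : Monad B) : MorphismProperty B :=
  fun _ _ f => IsIso ((T : B ⥤ B).map f)

/-- The `T`-closed `M`-embeddings. -/
def TClosedEmb (H : Bᵒᵖ ⥤ B ⥤ V) (T : Monad B) (M : MorphismProperty B) : MorphismProperty B :=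
  rightOrthogonal H (invertedBy T) ⊓ M

/-- The `T`-dense morphisms. -/
def TDense (H : Bᵒᵖ ⥤ B ⥤ V) (T : Monad B) (M : MorphismProperty B) : MorphismProperty B :=
  leftOrthogonal H (TClosedEmb H T M)

/-- `c` is a `T`-closure of the `M`-embedding `m`: it is the second factor of a factorization of
`m` as a `T`-dense morphism followed by a `T`-closed `M`-embedding. -/
def IsTClosure (H : Bᵒᵖ ⥤ B ⥤ V) (T : Monad B) (M : MorphismProperty B)
    {A C W : B} (m : A ⟶ W) (c : C ⟶ W) : Prop :=
  M m ∧ ∃ d : A ⟶ C, TDense H T M d ∧ TClosedEmb H T M c ∧ d ≫ c = m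

end General

end EnrichedClosure

namespace NormedClosure

/-! ### The categories of seminormed and of normed spaces -/

/-- Which of the two categories is considered. -/
inductive Kind
  | seminormed
  | normed

/-- For `k = .seminormed`: a seminormed space over `𝕜`.
For `k = .normed`: a normed space over `𝕜`. -/
structure NSpace (𝕜 : Type) [RCLike 𝕜] (k : Kind) : Type (u + 1) where
  carrier : Type u
  [seminormed : SeminormedAddCommGroup carrier]
  [normedSpace : NormedSpace 𝕜 carrier]
  separated : k = Kind.normed → ∀ x : carrier, ‖x‖ = 0 → x = 0

attribute [instance] NSpace.seminormed NSpace.normedSpace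

variable {𝕜 : Type} [RCLike 𝕜] {k : Kind}

instance : CoeSort (NSpace.{u} 𝕜 k) (Type u) := ⟨NSpace.carrier⟩

namespace NSpace

/-- Nonexpansive linear maps. -/
@[ext]
structure Hom (V W : NSpace.{u} 𝕜 k) where
  toCLM : V →L[𝕜] W
  norm_le : ∀ x, ‖toCLM x‖ ≤ ‖x‖

instance : Category.{u} (NSpace.{u} 𝕜 k) where
  Hom := Hom
  id V := ⟨ContinuousLinearMap.id 𝕜 V, fun _ => le_rfl⟩
  comp f g := ⟨g.toCLM.comp f.toCLM, fun x => (g.norm_le _).trans (f.norm_le x)⟩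

@[ext]
theorem hom_ext {V W : NSpace.{u} 𝕜 k} {f g : V ⟶ W} (h : ∀ x, f.toCLM x = g.toCLM x) : f = g :=
  Hom.ext (ContinuousLinearMap.ext h)

@[simp]
theorem id_toCLM (V : NSpace.{u} 𝕜 k) : Hom.toCLM (𝟙 V) = ContinuousLinearMap.id 𝕜 V := rfl

@[simp]
theorem comp_toCLM {U V W : NSpace.{u} 𝕜 k} (f : U ⟶ V) (g : V ⟶ W) :
    Hom.toCLM (f ≫ g) = g.toCLM.comp f.toCLM := rfl

theorem norm_toCLM_le {V W : NSpace.{u} 𝕜 k} (f : V ⟶ W) : ‖f.toCLM‖ ≤ 1 :=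
  ContinuousLinearMap.opNorm_le_bound _ zero_le_one fun x => by
    simpa only [one_mul] using f.norm_le x

theorem eq_zero_of_norm_eq_zero {V W : Type*} [SeminormedAddCommGroup V] [NormedSpace 𝕜 V]
    [SeminormedAddCommGroup W] [NormedSpace 𝕜 W] (hW : ∀ y : W, ‖y‖ = 0 → y = 0)
    (f : V →L[𝕜] W) (hf : ‖f‖ = 0) : f = 0 := by
  ext x
  refine hW _ (le_antisymm ?_ (norm_nonneg _))
  simpa [hf] using f.le_opNorm x

/-- The internal hom: all bounded linear maps, with the operator (semi)norm. -/
noncomputable def ihomObj (V W : NSpace.{u} 𝕜 k) : NSpace.{u} 𝕜 k where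
  carrier := V →L[𝕜] W
  separated hk f hf := eq_zero_of_norm_eq_zero (W.separated hk) f hf

/-- The internal hom bifunctor. -/
noncomputable def ihom : (NSpace.{u} 𝕜 k)ᵒᵖ ⥤ NSpace.{u} 𝕜 k ⥤ NSpace.{u} 𝕜 k where
  obj V :=
    { obj := fun W => ihomObj V.unop W
      map := fun {W₁ W₂} g =>
        { toCLM := ContinuousLinearMap.compL 𝕜 V.unop W₁ W₂ g.toCLM
          norm_le := fun (φ : V.unop →L[𝕜] W₁) =>
            (g.toCLM.opNorm_comp_le φ).trans
              (mul_le_of_le_one_left (norm_nonneg φ) (norm_toCLM_le g)) } }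
  map {V₁ V₂} h :=
    { app := fun W =>
        { toCLM := (ContinuousLinearMap.compL 𝕜 V₂.unop V₁.unop W).flip h.unop.toCLM
          norm_le := fun (φ : V₁.unop →L[𝕜] W) =>
            (φ.opNorm_comp_le h.unop.toCLM).trans
              (mul_le_of_le_one_right (norm_nonneg φ) (norm_toCLM_le h.unop)) } }

/-! ### The double-dualization monad -/

/-- The space of all bounded linear functionals on `V`. -/
noncomputable def dualObj (V : NSpace.{u} 𝕜 k) : NSpace.{u} 𝕜 k where
  carrier := V →L[𝕜] 𝕜
  separated _ f hf := eq_zero_of_norm_eq_zero (fun _ => norm_eq_zero.1) f hf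

/-- The dualization functor, which sends `h` to `ψ ↦ ψ ∘ h`. -/
noncomputable def dual : (NSpace.{u} 𝕜 k)ᵒᵖ ⥤ NSpace.{u} 𝕜 k where
  obj V := dualObj V.unop
  map {V₁ V₂} h :=
    { toCLM := (ContinuousLinearMap.compL 𝕜 V₂.unop V₁.unop 𝕜).flip h.unop.toCLM
      norm_le := fun (φ : V₁.unop →L[𝕜] 𝕜) =>
        (φ.opNorm_comp_le h.unop.toCLM).trans
          (mul_le_of_le_one_right (norm_nonneg φ) (norm_toCLM_le h.unop)) }

/-- The canonical map `V ⟶ V**`, `v ↦ (ψ ↦ ψ v)`. -/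
noncomputable def eval (V : NSpace.{u} 𝕜 k) : V ⟶ dualObj (dualObj V) where
  toCLM := (ContinuousLinearMap.id 𝕜 (V →L[𝕜] 𝕜)).flip
  norm_le x := ContinuousLinearMap.opNorm_le_bound _ (norm_nonneg x) fun (φ : V →L[𝕜] 𝕜) =>
    (φ.le_opNorm x).trans_eq (mul_comm _ _)

/-- The dualization adjunction, whose unit and counit are both given by `eval`. -/
noncomputable def dualAdjunction :
    (dual (𝕜 := 𝕜) (k := k)).rightOp ⊣ dual.{u} (𝕜 := 𝕜) (k := k) :=
  Adjunction.mkOfUnitCounit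
    { unit := { app := fun V => eval V }
      counit := { app := fun V => (eval V.unop).op } }

/-- The double-dualization monad: its endofunctor is `V ↦ V**`, its unit is `eval`. -/
noncomputable def bidualMonad (𝕜 : Type) [RCLike 𝕜] (k : Kind) : Monad (NSpace.{u} 𝕜 k) :=
  dualAdjunction.toMonad

/-! ### Classes of morphisms and subspaces -/

/-- The surjective morphisms. -/
def surjective (𝕜 : Type) [RCLike 𝕜] (k : Kind) : MorphismProperty (NSpace.{u} 𝕜 k) :=
  fun _ _ f => Function.Surjective f.toCLM

/-- The isometric embeddings, i.e. the norm-preserving injective morphisms. -/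
def isometricEmbedding (𝕜 : Type) [RCLike 𝕜] (k : Kind) : MorphismProperty (NSpace.{u} 𝕜 k) :=
  fun _ _ f => (∀ x, ‖f.toCLM x‖ = ‖x‖) ∧ Function.Injective f.toCLM

/-- A linear subspace of `W`, with the restricted norm. -/
def subspace (W : NSpace.{u} 𝕜 k) (S : Submodule 𝕜 W) : NSpace.{u} 𝕜 k where
  carrier := S
  separated hk _ hx := Subtype.ext (W.separated hk _ hx)

/-- The inclusion of a linear subspace. -/
def inclusion (W : NSpace.{u} 𝕜 k) (S : Submodule 𝕜 W) : W.subspace S ⟶ W where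
  toCLM := S.subtypeL
  norm_le _ := le_rfl

end NSpace

end NormedClosure

open EnrichedClosure NormedClosure

/-! Against an isometric embedding `m`, orthogonality reduces to a condition on images: a bounded
map that sends the image of `e` into the image of `m` must take all its values there, since lifts
through `m` are then automatically unique, linear and of the right norm
(`vOrthogonal_of_range_subset`). So surjections are orthogonal to all isometric embeddings, and
dense maps to the closed ones. The converses come from testing a morphism against a factor of its
own factorization through its range or the closure of its range, where the diagonal filler forces
the other factor to be trivial.

The monad enters only through two bounds on the class it inverts. Every inverted morphism is dense,
by Hahn–Banach (`denseRange_of_invertedBy`), and every dense isometric embedding is inverted,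
because functionals extend uniquely along it with the same norm
(`invertedBy_of_isometricEmbedding_of_denseRange`). Both bounds single out the same isometric
embeddings by orthogonality, namely those with closed image. -/

namespace NormedClosure.NSpace

variable {𝕜 : Type} [RCLike 𝕜] {k : Kind}

/-! ### Monomorphisms and isomorphisms -/

theorem mono_of_injective {V W : NSpace.{u} 𝕜 k} (f : V ⟶ W)
    (hf : Function.Injective f.toCLM) : Mono f where
  right_cancellation _ _ e := hom_ext fun x =>
    hf (DFunLike.congr_fun (congrArg Hom.toCLM e) x)

theorem isIso_of_isometricEmbedding_of_surjective {V W : NSpace.{u} 𝕜 k} (f : V ⟶ W)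
    (hf : isometricEmbedding 𝕜 k f) (hs : Function.Surjective f.toCLM) : IsIso f := by
  let e : V ≃ₗ[𝕜] W := LinearEquiv.ofBijective f.toCLM.toLinearMap ⟨hf.2, hs⟩
  have he : ∀ y, f.toCLM (e.symm y) = y := e.apply_symm_apply
  let E : W →ₗᵢ[𝕜] V := ⟨e.symm.toLinearMap, fun y => by
    conv_rhs => rw [← he y]
    exact (hf.1 _).symm⟩
  refine ⟨⟨E.toContinuousLinearMap, fun y => (E.norm_map y).le⟩, hom_ext fun x => ?_,
    hom_ext fun y => he y⟩
  exact e.symm_apply_apply x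

theorem isometricEmbedding_of_isIso {V W : NSpace.{u} 𝕜 k} (f : V ⟶ W) [IsIso f] :
    isometricEmbedding 𝕜 k f := by
  have h : ∀ x, (inv f).toCLM (f.toCLM x) = x := fun x =>
    DFunLike.congr_fun (congrArg Hom.toCLM (IsIso.hom_inv_id f)) x
  refine ⟨fun x => le_antisymm (f.norm_le x) ?_, Function.LeftInverse.injective h⟩
  conv_lhs => rw [← h x]
  exact (inv f).norm_le _

theorem surjective_of_isIso {V W : NSpace.{u} 𝕜 k} (f : V ⟶ W) [IsIso f] :
    Function.Surjective f.toCLM := fun y =>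
  ⟨(inv f).toCLM y, DFunLike.congr_fun (congrArg Hom.toCLM (IsIso.inv_hom_id f)) y⟩

/-! ### Factorization through a subspace -/

theorem isometricEmbedding_inclusion (W : NSpace.{u} 𝕜 k) (S : Submodule 𝕜 W) :
    isometricEmbedding 𝕜 k (W.inclusion S) :=
  ⟨fun _ => rfl, Subtype.val_injective⟩

theorem range_inclusion (W : NSpace.{u} 𝕜 k) (S : Submodule 𝕜 W) :
    Set.range (W.inclusion S).toCLM = S :=
  Subtype.range_coe

/-- A morphism with values in a subspace, regarded as a morphism to that subspace. -/
noncomputable def corestrict {V W : NSpace.{u} 𝕜 k} (f : V ⟶ W) (S : Submodule 𝕜 W)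
    (h : ∀ x, f.toCLM x ∈ S) : V ⟶ W.subspace S where
  toCLM := f.toCLM.codRestrict S h
  norm_le := f.norm_le

theorem corestrict_comp_inclusion {V W : NSpace.{u} 𝕜 k} (f : V ⟶ W) (S : Submodule 𝕜 W)
    (h : ∀ x, f.toCLM x ∈ S) : corestrict f S h ≫ W.inclusion S = f := rfl

/-- The range of a morphism, as a subspace. -/
def range {V W : NSpace.{u} 𝕜 k} (f : V ⟶ W) : Submodule 𝕜 W :=
  LinearMap.range f.toCLM.toLinearMap

theorem apply_mem_range {V W : NSpace.{u} 𝕜 k} (f : V ⟶ W) (x : V) : f.toCLM x ∈ range f :=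
  ⟨x, rfl⟩

theorem apply_mem_closure_range {V W : NSpace.{u} 𝕜 k} (f : V ⟶ W) (x : V) :
    f.toCLM x ∈ (range f).topologicalClosure :=
  (range f).le_topologicalClosure (apply_mem_range f x)

theorem surjective_corestrict_range {V W : NSpace.{u} 𝕜 k} (f : V ⟶ W) :
    Function.Surjective (corestrict f (range f) (apply_mem_range f)).toCLM := by
  rintro ⟨_, x, rfl⟩
  exact ⟨x, rfl⟩

theorem denseRange_corestrict {V W : NSpace.{u} 𝕜 k} (f : V ⟶ W) (S : Submodule 𝕜 W)
    (h : ∀ x, f.toCLM x ∈ S) (hS : (S : Set W) ⊆ closure (Set.range f.toCLM)) :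
    DenseRange (corestrict f S h).toCLM := by
  intro y
  have := hS y.2
  rw [← corestrict_comp_inclusion f S h] at this
  rw [show Set.range (corestrict f S h ≫ W.inclusion S).toCLM = _ from
    Set.range_comp Subtype.val (corestrict f S h).toCLM] at this
  exact closure_subtype.2 this

/-! ### Orthogonality -/

/-- The unit object: the scalar field. -/
noncomputable def unit (𝕜 : Type) [RCLike 𝕜] (k : Kind) : NSpace.{u} 𝕜 k where
  carrier := ULift.{u} 𝕜
  separated _ x hx := ULift.down_injective ((norm_eq_zero (a := x.down)).1 hx)

/-- The element of the internal hom given by a morphism. -/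
noncomputable def name {V W : NSpace.{u} 𝕜 k} (f : V ⟶ W) : unit 𝕜 k ⟶ ihomObj V W where
  toCLM := (ContinuousLinearMap.toSpanSingleton 𝕜 f.toCLM).comp
    (ContinuousLinearEquiv.ulift (R₁ := 𝕜) (M₁ := 𝕜)).toContinuousLinearMap
  norm_le x := by
    change ‖x.down • f.toCLM‖ ≤ ‖x.down‖
    rw [norm_smul]
    exact mul_le_of_le_one_right (norm_nonneg _) (norm_toCLM_le f)

/-- Morphisms from the unit object to an internal hom correspond to morphisms of the category, so
testing the pullback on the unit object recovers ordinary diagonal fillers. -/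
theorem exists_lift_of_vOrthogonal {A₁ A₂ B₁ B₂ : NSpace.{u} 𝕜 k} {e : A₁ ⟶ A₂} {m : B₁ ⟶ B₂}
    (h : VOrthogonal ihom e m) (f : A₁ ⟶ B₁) (g : A₂ ⟶ B₂) (w : f ≫ m = e ≫ g) :
    ∃ d : A₂ ⟶ B₁, e ≫ d = f ∧ d ≫ m = g := by
  have hw : name g ≫ (ihom.map e.op).app B₂ = name f ≫ (ihom.obj (op A₁)).map m := by
    refine hom_ext fun x => ContinuousLinearMap.ext fun a => ?_
    change x.down • g.toCLM (e.toCLM a) = m.toCLM (x.down • f.toCLM a)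
    rw [map_smul]
    exact congrArg (x.down • ·) (DFunLike.congr_fun (congrArg Hom.toCLM w) a).symm
  let l := h.lift (name g) (name f) hw
  let φ : A₂ →L[𝕜] B₁ := l.toCLM (ULift.up 1)
  have h₁ : m.toCLM.comp φ = g.toCLM :=
    (DFunLike.congr_fun (congrArg Hom.toCLM (h.lift_fst (name g) (name f) hw))
      (ULift.up 1)).trans (one_smul 𝕜 g.toCLM)
  have h₂ : φ.comp e.toCLM = f.toCLM :=
    (DFunLike.congr_fun (congrArg Hom.toCLM (h.lift_snd (name g) (name f) hw))
      (ULift.up 1)).trans (one_smul 𝕜 f.toCLM)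
  have hφ : ‖φ‖ ≤ 1 := (l.norm_le (ULift.up 1)).trans (norm_one (α := 𝕜)).le
  exact ⟨⟨φ, fun x => (φ.le_of_opNorm_le hφ x).trans_eq (one_mul _)⟩, Hom.ext h₂, Hom.ext h₁⟩

theorem mono_ihom_map {V W : NSpace.{u} 𝕜 k} {m : V ⟶ W} (hm : isometricEmbedding 𝕜 k m)
    (A : NSpace.{u} 𝕜 k) : Mono ((ihom.obj (op A)).map m) :=
  mono_of_injective _ fun _ _ h => ContinuousLinearMap.ext fun a =>
    hm.2 (DFunLike.congr_fun (F := A →L[𝕜] W) h a)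

theorem vOrthogonal_of_range_subset {A₁ A₂ B₁ B₂ : NSpace.{u} 𝕜 k} {e : A₁ ⟶ A₂} {m : B₁ ⟶ B₂}
    (hm : isometricEmbedding 𝕜 k m)
    (h : ∀ φ : A₂ →L[𝕜] B₂, (∀ a, φ (e.toCLM a) ∈ Set.range m.toCLM) →
      ∀ a, φ a ∈ Set.range m.toCLM) :
    VOrthogonal ihom e m := by
  have w : (ihom.obj (op A₂)).map m ≫ (ihom.map e.op).app B₂ =
      (ihom.map e.op).app B₁ ≫ (ihom.obj (op A₁)).map m := rfl
  have key : ∀ (s : Limits.PullbackCone ((ihom.map e.op).app B₂) ((ihom.obj (op A₁)).map m)),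
      ∃ l : s.pt ⟶ (ihom.obj (op A₂)).obj B₁, l ≫ (ihom.obj (op A₂)).map m = s.fst := by
    intro s
    let φ : s.pt →L[𝕜] A₂ →L[𝕜] B₂ := s.fst.toCLM
    let ψ : s.pt →L[𝕜] A₁ →L[𝕜] B₁ := s.snd.toCLM
    -- The cone condition says that `φ x` composed with `e` equals `m` composed with `ψ x`, which is
    -- what `h` asks for.
    have hs : ∀ x a, ∃ b, m.toCLM b = φ x a := fun x =>
      h (φ x) fun a => ⟨ψ x a,
        (DFunLike.congr_fun (F := A₁ →L[𝕜] B₂)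
          (DFunLike.congr_fun (congrArg Hom.toCLM s.condition) x) a).symm⟩
    choose d hd using hs
    have hn : ∀ x a, ‖d x a‖ ≤ ‖x‖ * ‖a‖ := fun x a => by
      rw [← hm.1, hd]
      exact (ContinuousLinearMap.le_opNorm _ a).trans
        (mul_le_mul_of_nonneg_right (s.fst.norm_le x) (norm_nonneg a))
    -- The pointwise choice `d` is bilinear because it is so after applying the injective map `m`.
    let D : s.pt →ₗ[𝕜] A₂ →ₗ[𝕜] B₁ := LinearMap.mk₂ 𝕜 d
      (fun x y a => hm.2 (by
        simp only [map_add, hd, add_apply]))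
      (fun c x a => hm.2 (by simp only [map_smul, hd, smul_apply]))
      (fun x a b => hm.2 (by simp only [map_add, hd]))
      (fun c x a => hm.2 (by simp only [map_smul, hd]))
    let L : s.pt →L[𝕜] A₂ →L[𝕜] B₁ := D.mkContinuous₂ 1 fun x a => by
      rw [one_mul]; exact hn x a
    exact ⟨⟨L, fun x => ContinuousLinearMap.opNorm_le_bound _ (norm_nonneg x) (hn x)⟩,
      hom_ext fun x => ContinuousLinearMap.ext (hd x)⟩
  have := mono_ihom_map hm A₁
  have := mono_ihom_map hm A₂
  choose l hl using key
  exact ⟨⟨w⟩, ⟨Limits.PullbackCone.IsLimit.mk w l hl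
    (fun s => by
      rw [← cancel_mono ((ihom.obj (op A₁)).map m), ← s.condition, Category.assoc, ← w,
        ← Category.assoc, hl])
    (fun s q hq _ => by rw [← cancel_mono ((ihom.obj (op A₂)).map m), hq, hl])⟩⟩

theorem vOrthogonal_of_surjective {A₁ A₂ B₁ B₂ : NSpace.{u} 𝕜 k} {e : A₁ ⟶ A₂} {m : B₁ ⟶ B₂}
    (he : Function.Surjective e.toCLM) (hm : isometricEmbedding 𝕜 k m) :
    VOrthogonal ihom e m :=
  vOrthogonal_of_range_subset hm fun _ h => he.forall.2 h

theorem vOrthogonal_of_denseRange {A₁ A₂ B₁ B₂ : NSpace.{u} 𝕜 k} {e : A₁ ⟶ A₂} {m : B₁ ⟶ B₂}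
    (he : DenseRange e.toCLM) (hm : isometricEmbedding 𝕜 k m)
    (hc : IsClosed (Set.range m.toCLM)) : VOrthogonal ihom e m :=
  vOrthogonal_of_range_subset hm fun φ h => isClosed_property he (hc.preimage φ.continuous) h

/-- If `e ≫ m` is orthogonal to `m`, then `m` is surjective. -/
theorem surjective_of_vOrthogonal {V Z W : NSpace.{u} 𝕜 k} {e : V ⟶ Z} {m : Z ⟶ W}
    (h : VOrthogonal ihom (e ≫ m) m) : Function.Surjective m.toCLM := by
  -- In the square with left side `e` and right side `𝟙 W`, the filler is a section of `m`.
  obtain ⟨d, -, hd⟩ := exists_lift_of_vOrthogonal h e (𝟙 W) (Category.comp_id _).symm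
  exact fun y => ⟨d.toCLM y, DFunLike.congr_fun (congrArg Hom.toCLM hd) y⟩

/-- If `e` is orthogonal to `e ≫ m`, then the range of `m` is contained in that of `e ≫ m`. -/
theorem range_subset_of_vOrthogonal {V Z W : NSpace.{u} 𝕜 k} {e : V ⟶ Z} {m : Z ⟶ W}
    (h : VOrthogonal ihom e (e ≫ m)) : Set.range m.toCLM ⊆ Set.range (e ≫ m).toCLM := by
  -- The filler `d : Z ⟶ V` factors `m` through `e ≫ m`.
  obtain ⟨d, -, hd⟩ := exists_lift_of_vOrthogonal h (𝟙 V) m (Category.id_comp _)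
  rintro _ ⟨z, rfl⟩
  exact ⟨d.toCLM z, DFunLike.congr_fun (congrArg Hom.toCLM hd) z⟩

/-! ### Surjections and isometric embeddings -/

theorem isVFactorizationSystem_surjective_isometricEmbedding (𝕜 : Type) [RCLike 𝕜] (k : Kind) :
    IsVFactorizationSystem ihom.{u} (surjective 𝕜 k) (isometricEmbedding 𝕜 k) where
  right_eq := by
    ext V W f
    refine ⟨fun h => ?_, fun hf _ _ e he => vOrthogonal_of_surjective he hf⟩
    have hs := surjective_corestrict_range f
    -- The filler is a nonexpansive retraction of `f` corestricted to its range, so `f` can neither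
    -- shrink norms nor identify points.
    obtain ⟨d, hd, -⟩ := exists_lift_of_vOrthogonal (h _ hs) (𝟙 V) (W.inclusion (range f))
      (Category.id_comp _)
    have hd' : ∀ x, d.toCLM ((corestrict f (range f) (apply_mem_range f)).toCLM x) = x := fun x =>
      DFunLike.congr_fun (congrArg Hom.toCLM hd) x
    refine ⟨fun x => le_antisymm (f.norm_le x) ?_, fun x y hxy => ?_⟩
    · conv_lhs => rw [← hd' x]
      exact d.norm_le _
    · rw [← hd' x, ← hd' y]
      exact congrArg d.toCLM (Subtype.ext hxy)
  left_eq := by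
    ext V W f
    refine ⟨fun h => ?_, fun hf _ _ m hm => vOrthogonal_of_surjective hf hm⟩
    have := surjective_of_vOrthogonal (e := corestrict f (range f) (apply_mem_range f))
      (h _ (isometricEmbedding_inclusion W (range f)))
    intro y
    obtain ⟨⟨_, x, rfl⟩, rfl⟩ := this y
    exact ⟨x, rfl⟩
  factors {V W} f := ⟨W.subspace (range f), _, W.inclusion (range f),
    surjective_corestrict_range f, isometricEmbedding_inclusion W _, rfl⟩

theorem isVProper_surjective_isometricEmbedding (𝕜 : Type) [RCLike 𝕜] (k : Kind) :
    IsVProper ihom.{u} (surjective 𝕜 k) (isometricEmbedding 𝕜 k) where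
  vepi {V _} _ he A := mono_of_injective _ fun _ _ h => ContinuousLinearMap.ext <|
    he.forall.2 fun a => DFunLike.congr_fun (F := V →L[𝕜] A) h a
  vmono _ hm A := mono_ihom_map hm A

/-! ### Morphisms inverted by double dualization -/

/-- Hahn–Banach in the quotient by the closure of `S`: that quotient is genuinely normed even when
`E` is only seminormed, and the class of `x` in it is nonzero. -/
theorem exists_dual_ne_zero_of_notMem_closure {E : Type*} [SeminormedAddCommGroup E]
    [NormedSpace 𝕜 E] (S : Submodule 𝕜 E) {x : E} (hx : x ∉ S.topologicalClosure) :
    ∃ φ : E →L[𝕜] 𝕜, φ x ≠ 0 ∧ ∀ y ∈ S, φ y = 0 := by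
  have : IsClosed (S.topologicalClosure : Set E) := S.isClosed_topologicalClosure
  have hq : S.topologicalClosure.mkQ x ≠ 0 := by simpa using hx
  obtain ⟨g, -, hg⟩ := exists_dual_vector 𝕜 (S.topologicalClosure.mkQ x) (norm_ne_zero_iff.2 hq)
  refine ⟨g.comp S.topologicalClosure.mkQL, ?_, fun y hy => ?_⟩
  · change g (S.topologicalClosure.mkQ x) ≠ 0
    rw [hg]
    exact_mod_cast norm_ne_zero_iff.2 hq
  · have : S.topologicalClosure.mkQ y = 0 := by
      simpa using S.le_topologicalClosure hy
    change g (S.topologicalClosure.mkQ y) = 0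
    rw [this, map_zero]

theorem denseRange_of_invertedBy {V W : NSpace.{u} 𝕜 k} (h : V ⟶ W)
    (hh : invertedBy (bidualMonad 𝕜 k) h) : DenseRange h.toCLM := by
  by_contra hd
  obtain ⟨x, hx⟩ := not_forall.1 hd
  obtain ⟨φ, hφ, h0⟩ := exists_dual_ne_zero_of_notMem_closure (range h) (x := x) hx
  have : IsIso (dual.map (dual.map h.op).op) := hh
  -- Evaluation at `x` is the image of some `ζ` under the bidual of `h`. Applied to `φ`, it gives `φ
  -- x = ζ (φ ∘ h) = ζ 0 = 0`, a contradiction.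
  obtain ⟨ζ, hζ⟩ := surjective_of_isIso (dual.map (dual.map h.op).op) ((eval W).toCLM x)
  have h1 : (show (V →L[𝕜] 𝕜) →L[𝕜] 𝕜 from ζ) (φ.comp h.toCLM) = φ x :=
    DFunLike.congr_fun (F := (W →L[𝕜] 𝕜) →L[𝕜] 𝕜) hζ φ
  have h2 : φ.comp h.toCLM = 0 := ContinuousLinearMap.ext fun a => h0 _ (apply_mem_range h a)
  rw [h2, map_zero] at h1
  exact hφ h1.symm

/-- Already the first dual of `f` is invertible: restriction of functionals preserves norms and is
injective by density, and it is surjective because functionals on a dense subspace extend to the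
complete field `𝕜`. -/
theorem invertedBy_of_isometricEmbedding_of_denseRange {V W : NSpace.{u} 𝕜 k} (f : V ⟶ W)
    (hf : isometricEmbedding 𝕜 k f) (hd : DenseRange f.toCLM) :
    invertedBy (bidualMonad 𝕜 k) f := by
  have hi : IsUniformInducing f.toCLM :=
    (AddMonoidHomClass.isometry_of_norm f.toCLM hf.1).isUniformInducing
  have : IsIso (dual.map f.op) := by
    refine isIso_of_isometricEmbedding_of_surjective _ ⟨fun (φ : W →L[𝕜] 𝕜) => ?_,
      fun (φ : W →L[𝕜] 𝕜) (ψ : W →L[𝕜] 𝕜) h => ?_⟩ fun (φ : V →L[𝕜] 𝕜) => ?_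
    · refine le_antisymm ((dual.map f.op).norm_le φ) ?_
      change ‖φ‖ ≤ ‖φ.comp f.toCLM‖
      refine ContinuousLinearMap.opNorm_le_bound _ (norm_nonneg _) ?_
      refine isClosed_property hd (isClosed_le (by fun_prop) (by fun_prop)) fun a => ?_
      rw [hf.1]
      exact (φ.comp f.toCLM).le_opNorm a
    · exact DFunLike.coe_injective (F := W →L[𝕜] 𝕜) <| hd.equalizer φ.continuous ψ.continuous
        (funext fun a => DFunLike.congr_fun (F := V →L[𝕜] 𝕜) h a)
    · exact ⟨φ.extend f.toCLM, ContinuousLinearMap.ext (φ.extend_eq hd hi)⟩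
  have : IsIso (dual.rightOp.map f) := inferInstanceAs (IsIso (dual.map f.op).op)
  exact inferInstanceAs (IsIso (dual.map (dual.rightOp.map f)))

/-! ### Density and closure -/

theorem tClosedEmb_iff {V W : NSpace.{u} 𝕜 k} (f : V ⟶ W) :
    TClosedEmb ihom (bidualMonad 𝕜 k) (isometricEmbedding 𝕜 k) f ↔
      isometricEmbedding 𝕜 k f ∧ IsClosed (Set.range f.toCLM) := by
  refine ⟨fun ⟨ho, hf⟩ => ⟨hf, ?_⟩, fun ⟨hf, hc⟩ => ⟨fun _ _ h hh =>
    vOrthogonal_of_denseRange (denseRange_of_invertedBy h hh) hf hc, hf⟩⟩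
  -- The corestriction of `f` to the closure of its range is a dense isometric embedding, hence
  -- inverted by the monad. Its orthogonality to `f` puts the closure inside the range.
  let d := corestrict f _ (apply_mem_closure_range f)
  have hd : DenseRange d.toCLM := denseRange_corestrict f _ _ subset_rfl
  have hdi : isometricEmbedding 𝕜 k d := ⟨hf.1, fun x y h => hf.2 (congrArg Subtype.val h)⟩
  have := range_subset_of_vOrthogonal (m := W.inclusion _)
    (ho d (invertedBy_of_isometricEmbedding_of_denseRange d hdi hd))
  rw [range_inclusion] at this
  exact isClosed_of_closure_subset this

theorem tClosedEmb_inclusion_topologicalClosure (W : NSpace.{u} 𝕜 k) (S : Submodule 𝕜 W) :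
    TClosedEmb ihom (bidualMonad 𝕜 k) (isometricEmbedding 𝕜 k)
      (W.inclusion S.topologicalClosure) :=
  (tClosedEmb_iff _).2 ⟨isometricEmbedding_inclusion _ _, by
    rw [range_inclusion]; exact S.isClosed_topologicalClosure⟩

theorem tDense_iff {V W : NSpace.{u} 𝕜 k} (f : V ⟶ W) :
    TDense ihom (bidualMonad 𝕜 k) (isometricEmbedding 𝕜 k) f ↔ DenseRange f.toCLM := by
  refine ⟨fun h => ?_, fun h _ _ m hm =>
    have hm := (tClosedEmb_iff m).1 hm
    vOrthogonal_of_denseRange h hm.1 hm.2⟩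
  -- The inclusion of the closure of the range is a `T`-closed embedding through which `f` factors,
  -- so orthogonality makes it surjective.
  have hs := surjective_of_vOrthogonal (e := corestrict f _ (apply_mem_closure_range f))
    (h _ (tClosedEmb_inclusion_topologicalClosure W (range f)))
  intro y
  obtain ⟨z, rfl⟩ := hs y
  exact z.2

theorem factors_tDense_tClosedEmb {V W : NSpace.{u} 𝕜 k} (f : V ⟶ W) :
    Factors (TDense ihom (bidualMonad 𝕜 k) (isometricEmbedding 𝕜 k))
      (TClosedEmb ihom (bidualMonad 𝕜 k) (isometricEmbedding 𝕜 k)) f :=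
  ⟨_, corestrict f _ (apply_mem_closure_range f), W.inclusion _,
    (tDense_iff _).2 (denseRange_corestrict f _ _ subset_rfl),
    tClosedEmb_inclusion_topologicalClosure W (range f), rfl⟩

theorem isTClosure_inclusion_iff (W : NSpace.{u} 𝕜 k) (S : Submodule 𝕜 W) {C : NSpace.{u} 𝕜 k}
    (c : C ⟶ W) :
    IsTClosure ihom (bidualMonad 𝕜 k) (isometricEmbedding 𝕜 k) (W.inclusion S) c ↔
      ∃ i : C ≅ W.subspace S.topologicalClosure,
        i.hom ≫ W.inclusion S.topologicalClosure = c := by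
  have hS : Set.range (W.inclusion S).toCLM = S := range_inclusion W S
  constructor
  · rintro ⟨-, d, hd, hc, hdc⟩
    rw [tDense_iff] at hd
    rw [tClosedEmb_iff] at hc
    have hsub : Set.range (d ≫ c).toCLM ⊆ Set.range c.toCLM :=
      Set.range_comp_subset_range d.toCLM c.toCLM
    rw [hdc, hS] at hsub
    -- Density of `d` keeps the image of `c` inside the closure of `S`. Conversely, that image is
    -- closed and contains `S`, hence contains the closure.
    have hmem : ∀ x, c.toCLM x ∈ S.topologicalClosure := by
      refine isClosed_property hd (S.isClosed_topologicalClosure.preimage c.toCLM.continuous)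
        fun a => S.le_topologicalClosure ?_
      rw [← SetLike.mem_coe, ← hS, ← hdc]
      exact ⟨a, rfl⟩
    have : IsIso (corestrict c _ hmem) := by
      refine isIso_of_isometricEmbedding_of_surjective _
        ⟨hc.1.1, fun x y h => hc.1.2 (congrArg Subtype.val h)⟩ ?_
      rintro ⟨y, hy⟩
      obtain ⟨x, rfl⟩ := closure_minimal hsub hc.2 hy
      exact ⟨x, rfl⟩
    exact ⟨asIso (corestrict c _ hmem), rfl⟩
  · rintro ⟨i, rfl⟩
    let d := corestrict (W.inclusion S) S.topologicalClosure
      fun x => S.le_topologicalClosure x.2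
    have hd : DenseRange d.toCLM := denseRange_corestrict _ _ _ (by rw [hS]; exact subset_rfl)
    refine ⟨isometricEmbedding_inclusion W S, d ≫ i.inv, ?_, ?_, ?_⟩
    · rw [tDense_iff]
      exact (surjective_of_isIso i.inv).denseRange.comp hd i.inv.toCLM.continuous
    · rw [tClosedEmb_iff]
      have hi := isometricEmbedding_of_isIso i.hom
      refine ⟨⟨hi.1, Subtype.val_injective.comp hi.2⟩, ?_⟩
      have : Set.range (i.hom ≫ W.inclusion S.topologicalClosure).toCLM =
          S.topologicalClosure :=
        ((surjective_of_isIso i.hom).range_comp _).trans (range_inclusion W _)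
      rw [this]
      exact S.isClosed_topologicalClosure
    · rw [Category.assoc, i.inv_hom_id_assoc]
      rfl

end NormedClosure.NSpace

theorem mainTheorem8 (𝕜 : Type) [RCLike 𝕜] (k : Kind) :
    -- (surjective, isometric embedding) is a `V`-proper `V`-factorization-system
    (IsVFactorizationSystem NSpace.ihom.{u}
        (NSpace.surjective 𝕜 k) (NSpace.isometricEmbedding 𝕜 k) ∧
      IsVProper NSpace.ihom.{u} (NSpace.surjective 𝕜 k) (NSpace.isometricEmbedding 𝕜 k)) ∧
    -- the `T`-dense morphisms are the dense ones
    (∀ {V W : NSpace.{u} 𝕜 k} (f : V ⟶ W),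
      TDense NSpace.ihom (NSpace.bidualMonad 𝕜 k) (NSpace.isometricEmbedding 𝕜 k) f ↔
        DenseRange f.toCLM) ∧
    -- the `T`-closed `M`-embeddings are the closed isometric embeddings
    (∀ {V W : NSpace.{u} 𝕜 k} (f : V ⟶ W),
      TClosedEmb NSpace.ihom (NSpace.bidualMonad 𝕜 k) (NSpace.isometricEmbedding 𝕜 k) f ↔
        (NSpace.isometricEmbedding 𝕜 k f ∧ IsClosed (Set.range f.toCLM))) ∧
    -- every morphism factors as a `T`-dense morphism followed by a `T`-closed `M`-embedding
    (∀ {V W : NSpace.{u} 𝕜 k} (f : V ⟶ W),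
      Factors (TDense NSpace.ihom (NSpace.bidualMonad 𝕜 k) (NSpace.isometricEmbedding 𝕜 k))
        (TClosedEmb NSpace.ihom (NSpace.bidualMonad 𝕜 k) (NSpace.isometricEmbedding 𝕜 k)) f) ∧
    -- the `T`-closure of a subspace is its usual closure (up to isomorphism of subobjects)
    (∀ (W : NSpace.{u} 𝕜 k) (S : Submodule 𝕜 W) {C : NSpace.{u} 𝕜 k} (c : C ⟶ W),
      IsTClosure NSpace.ihom (NSpace.bidualMonad 𝕜 k) (NSpace.isometricEmbedding 𝕜 k)
          (W.inclusion S) c ↔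
        ∃ i : C ≅ W.subspace S.topologicalClosure,
          i.hom ≫ W.inclusion S.topologicalClosure = c) := by
  exact ⟨⟨NSpace.isVFactorizationSystem_surjective_isometricEmbedding 𝕜 k,
      NSpace.isVProper_surjective_isometricEmbedding 𝕜 k⟩,
    NSpace.tDense_iff, NSpace.tClosedEmb_iff, NSpace.factors_tDense_tClosedEmb,
    fun W S _ => NSpace.isTClosure_inclusion_iff W S⟩
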